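/- Let $X$ be a real Banach space with topological dual $X^*$, and let $F:X\times X\to\mathbb{R}$ be a monotone bifunction, i.e. $F(x,y)+F(y,x)\le 0$ for all $x,y\in X$, such that $F(x,x)=0$ for all $x\in X$. Suppose that $F(x,\cdot)$ is convex and (norm-)continuous for every $x\in X$, and that $F(\cdot,y)$ is upper hemicontinuous, i.e. upper semicontinuous on line segments, for every $y\in X$. Then $F$ is maximal monotone, that is, the operator $A^F:X\rightrightarrows X^*$ defined by $$A^F(x)=\{x^*\in X^*: F(x,y)-F(x,x)\ge\langle x^*,y-x\rangle\ \text{ for all } y\in X\},\qquad x\in X,$$ is a maximal monotone operator: $\langle y^*-x^*,y-x\rangle\ge 0$ whenever $x^*\in A^F(x)$ and $y^*\in A^F(y)$, and the graph $\{(x,x^*)\in X\times X^*:x^*\in A^F(x)\}$ is not properly included in the graph of any other monotone operator $S:X\rightrightarrows X^*$. -/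

import Mathlib

/-- A multifunction `T : X ⇉ X*`, with `X*` the topological dual of `X`. -/
abbrev DualMultifunction (X : Type*) [NormedAddCommGroup X] [NormedSpace ℝ X] :=
  X → Set (StrongDual ℝ X)

namespace DualMultifunction

/-- The graph `{(x, x*) : x* ∈ T x}` of a multifunction. -/
def graph {X : Type*} [NormedAddCommGroup X] [NormedSpace ℝ X] (T : DualMultifunction X) :
    Set (X × StrongDual ℝ X) :=
  {p | p.2 ∈ T p.1}

/-- `T` is a monotone operator: `⟨y* - x*, y - x⟩ ≥ 0` whenever `x* ∈ T x` and `y* ∈ T y`. -/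
def IsMonotone {X : Type*} [NormedAddCommGroup X] [NormedSpace ℝ X]
    (T : DualMultifunction X) : Prop :=
  ∀ x y : X, ∀ xs ∈ T x, ∀ ys ∈ T y, 0 ≤ (ys - xs) (y - x)

/-- `T` is a maximal monotone operator: it is monotone and its graph is not properly included
in the graph of any monotone operator. -/
def IsMaximalMonotone {X : Type*} [NormedAddCommGroup X] [NormedSpace ℝ X]
    (T : DualMultifunction X) : Prop :=
  T.IsMonotone ∧ ∀ S : DualMultifunction X, S.IsMonotone → ¬ (graph T ⊂ graph S)

end DualMultifunction

/-- A (real-valued) bifunction on the whole space `X`. -/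
abbrev Bifunction (X : Type*) := X → X → ℝ

namespace Bifunction

/-- `F` is a monotone bifunction: `F(x, y) + F(y, x) ≤ 0` for all `x, y`. -/
def IsMonotone {X : Type*} (F : Bifunction X) : Prop :=
  ∀ x y : X, F x y + F y x ≤ 0

/-- The operator `A^F : X ⇉ X*` attached to `F`,
`A^F(x) = {x* : F(x, y) - F(x, x) ≥ ⟨x*, y - x⟩ for all y ∈ X}`. -/
def operatorA {X : Type*} [NormedAddCommGroup X] [NormedSpace ℝ X] (F : Bifunction X) :
    DualMultifunction X :=
  fun x => {xs | ∀ y : X, xs (y - x) ≤ F x y - F x x}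

/-- `F` is a maximal monotone bifunction: `F` is monotone and `A^F` is a maximal monotone
operator. -/
def IsMaximalMonotone {X : Type*} [NormedAddCommGroup X] [NormedSpace ℝ X]
    (F : Bifunction X) : Prop :=
  F.IsMonotone ∧ F.operatorA.IsMaximalMonotone

end Bifunction

/-- `f` is upper hemicontinuous: upper semicontinuous on line segments. -/
def UpperHemicontinuousOnSegments {X : Type*} [NormedAddCommGroup X] [NormedSpace ℝ X]
    (f : X → ℝ) : Prop :=
  ∀ a b : X, UpperSemicontinuousOn f (segment ℝ a b)

/-! Minty's argument: let `xs` at `x` be monotonically related to the graph of `A^F`, and put z = x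
+ t(y - x), 0 < t < 1. Hahn-Banach gives a subgradient z* of F(z, ·) at z, so z* ∈ A^F(z).
Relatedness yields ⟨z*, y - x⟩ ≥ ⟨xs, y - x⟩, whence F(z, y) ≥ (1 - t)⟨xs, y - x⟩; let t → 0⁺. -/

open Set Filter Topology in
/-- A continuous convex function on a real normed space is subdifferentiable at every point. -/
theorem ConvexOn.exists_subgradient {E : Type*} [NormedAddCommGroup E] [NormedSpace ℝ E]
    {φ : E → ℝ} (hφ : ConvexOn ℝ univ φ) (hc : Continuous φ) (x : E) :
    ∃ g : StrongDual ℝ E, ∀ y, g (y - x) ≤ φ y - φ x := by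
  have hconv : Convex ℝ {p : E × ℝ | φ p.1 < p.2} := by
    simpa using hφ.convex_strict_epigraph
  have hopen : IsOpen {p : E × ℝ | φ p.1 < p.2} :=
    isOpen_lt (hc.comp continuous_fst) continuous_snd
  obtain ⟨f, hf⟩ := geometric_hahn_banach_open_point (x := (x, φ x)) hconv hopen
    (by simp)
  have hsplit : ∀ (y : E) (r : ℝ), f (y, r) = f (y, 0) + r * f (0, 1) := fun y r => by
    rw [← smul_eq_mul, ← map_smul, ← map_add]
    simp
  -- The hyperplane is not vertical, so it can be rescaled into the graph of an affine minorant.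
  have hneg : f (0, 1) < 0 := by
    have h := hf (x, φ x + 1) (by simp)
    rw [hsplit x, hsplit x (φ x)] at h
    linarith
  refine ⟨(-f (0, 1))⁻¹ • f.comp (ContinuousLinearMap.inl ℝ E ℝ), fun y => ?_⟩
  have hsub : f (y - x, 0) = f (y, 0) - f (x, 0) := by
    rw [← map_sub]
    simp
  -- Only the strict epigraph is separated, so (y, φ y) is approached from above.
  refine le_of_forall_pos_lt_add fun ε hε => ?_
  have h := hf (y, φ y + ε) (by simpa using hε)
  rw [hsplit y, hsplit x (φ x)] at h
  simp only [smul_apply, ContinuousLinearMap.comp_apply,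
    ContinuousLinearMap.inl_apply, smul_eq_mul, hsub]
  rw [inv_mul_lt_iff₀ (neg_pos.2 hneg)]
  linarith

/-- The operator attached to a monotone bifunction vanishing on the diagonal is monotone. -/
theorem Bifunction.IsMonotone.operatorA_isMonotone {X : Type*} [NormedAddCommGroup X]
    [NormedSpace ℝ X] {F : Bifunction X} (hmono : F.IsMonotone) (hdiag : ∀ x : X, F x x = 0) :
    F.operatorA.IsMonotone := by
  intro x y xs hxs ys hys
  have h₁ := hxs y
  have h₂ := hys x
  have h₃ := hmono x y
  rw [hdiag] at h₁ h₂
  rw [← neg_sub y x, map_neg] at h₂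
  rw [sub_apply]
  linarith

open Set Filter Topology in
/-- An upper semicontinuous function on a segment which along the open segment is bounded below
by the linear interpolation `t ↦ (1 - t) * c` is at least `c` at the left endpoint. -/
theorem UpperHemicontinuousOnSegments.le_of_forall_lineMap {X : Type*} [NormedAddCommGroup X]
    [NormedSpace ℝ X] {f : X → ℝ} (hf : UpperHemicontinuousOnSegments f) {x y : X} {c : ℝ}
    (h : ∀ t ∈ Ioo (0 : ℝ) 1, (1 - t) * c ≤ f (AffineMap.lineMap x y t)) : c ≤ f x := by
  by_contra! hlt
  -- For small t > 0, f < d < (1 - t) * c at the point of parameter t, contradicting `h`.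
  obtain ⟨d, hxd, hdc⟩ := exists_between hlt
  have hline : Tendsto (fun t : ℝ => (AffineMap.lineMap x y t : X)) (𝓝[>] 0)
      (𝓝[segment ℝ x y] x) := by
    refine tendsto_nhdsWithin_iff.2 ⟨?_, ?_⟩
    · have hcont : Continuous fun t : ℝ => (AffineMap.lineMap x y t : X) :=
        AffineMap.lineMap_continuous
      simpa using (hcont.tendsto 0).mono_left nhdsWithin_le_nhds
    · filter_upwards [Ioo_mem_nhdsGT (zero_lt_one' ℝ)] with t ht
      rw [segment_eq_image_lineMap]
      exact mem_image_of_mem _ ⟨ht.1.le, ht.2.le⟩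
  have hmul : Tendsto (fun t : ℝ => (1 - t) * c) (𝓝[>] 0) (𝓝 c) := by
    have hcont : Continuous fun t : ℝ => (1 - t) * c := by fun_prop
    simpa using (hcont.tendsto 0).mono_left nhdsWithin_le_nhds
  obtain ⟨t, ⟨ht₁, ht₂⟩, ht⟩ := ((hline.eventually
    (hf x y x (left_mem_segment ℝ x y) d hxd)).and (hmul.eventually (lt_mem_nhds hdc))).and
      (Ioo_mem_nhdsGT (zero_lt_one' ℝ)) |>.exists
  linarith [h t ht]

/-- A functional monotonically related at `x` to the whole graph of the operator of `F` belongs to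
its value at `x`. -/
theorem Bifunction.mem_operatorA_of_monotonically_related {X : Type*} [NormedAddCommGroup X]
    [NormedSpace ℝ X] {F : Bifunction X} (hdiag : ∀ x : X, F x x = 0)
    (hconv : ∀ x : X, ConvexOn ℝ Set.univ (fun y => F x y))
    (hcont : ∀ x : X, Continuous (fun y => F x y))
    (husc : ∀ y : X, UpperHemicontinuousOnSegments (fun x => F x y))
    {x : X} {xs : StrongDual ℝ X}
    (h : ∀ z, ∀ zs ∈ F.operatorA z, 0 ≤ (zs - xs) (z - x)) : xs ∈ F.operatorA x := by
  intro y
  rw [hdiag, sub_zero]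
  refine (husc y).le_of_forall_lineMap (y := y) fun t ht => ?_
  -- A subgradient of F(z, ·) at z is exactly an element of A^F(z).
  obtain ⟨zs, hzs⟩ := (hconv (AffineMap.lineMap x y t)).exists_subgradient (hcont _)
    (AffineMap.lineMap x y t)
  have h₁ := h _ zs hzs
  have h₂ := hzs y
  have e₁ : AffineMap.lineMap x y t - x = t • (y - x) := by
    simp [AffineMap.lineMap_apply]
  have e₂ : y - AffineMap.lineMap x y t = (1 - t) • (y - x) := by
    simp only [AffineMap.lineMap_apply, vsub_eq_sub, vadd_eq_add]
    module
  rw [e₁, map_smul, smul_eq_mul, sub_apply] at h₁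
  rw [hdiag, sub_zero, e₂, map_smul, smul_eq_mul] at h₂
  have h₃ := nonneg_of_mul_nonneg_right h₁ ht.1
  exact (mul_le_mul_of_nonneg_left (sub_nonneg.1 h₃) (sub_nonneg.2 ht.2.le)).trans h₂

theorem mainTheorem9 {X : Type*} [NormedAddCommGroup X] [NormedSpace ℝ X] [CompleteSpace X]
    (F : Bifunction X)
    (hmono : F.IsMonotone)
    (hdiag : ∀ x : X, F x x = 0)
    (hconv : ∀ x : X, ConvexOn ℝ Set.univ (fun y => F x y))
    (hcont : ∀ x : X, Continuous (fun y => F x y))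
    (husc : ∀ y : X, UpperHemicontinuousOnSegments (fun x => F x y)) :
    F.IsMaximalMonotone := by
  refine ⟨hmono, hmono.operatorA_isMonotone hdiag, fun S hS hlt => hlt.2 ?_⟩
  rintro ⟨x, xs⟩ hx
  exact Bifunction.mem_operatorA_of_monotonically_related hdiag hconv hcont husc
    fun z zs hz => hS x z xs hx zs (hlt.1 (show (z, zs) ∈ F.operatorA.graph from hz))
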